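/- Let $(T_n)_{n\ge 1}$ be the uniform random recursive tree: $T_1$ is the single vertex $1$ (the root), and, for every $n\ge 1$, $T_{n+1}$ is obtained from $T_n$ by adding a new vertex $n+1$ and joining it by an edge to a vertex chosen uniformly at random from $[n]=\{1,\dots,n\}$, independently of the previous choices. For vertices $v,u$ of $T_n$, let $(T_n,v)_{u\downarrow}$ be the set of vertices $w$ of $T_n$ such that the path from $w$ to $v$ contains $u$. The Jordan centrality of $v$ is \[ \psi_{T_n}(v)=\max_{u\in[n]\setminus\{v\}} |(T_n,v)_{u\downarrow}| \] (with $\psi_{T_1}(1)=0$); smaller values mean more central. Vertices are ranked from most to least central, and among vertices of equal centrality the one with the larger label comes first. The Jordan rank of the root is the position of vertex $1$ in this ranking, i.e. \[ R_n = 1+\bigl|\{v\in[n] : \psi_{T_n}(v)<\psi_{T_n}(1), \text{ or } \psi_{T_n}(v)=\psi_{T_n}(1) \text{ and } v>1\}\bigr| . \] Theorem. The Jordan rank of the root is persistent: there exist finite integer-valued random variables $R$ and $N$ such that, with probability one, $\lim_{n\to\infty}R_n=R$ and $R_n=R$ for all $n\ge N$. -/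

import Mathlib

open MeasureTheory ProbabilityTheory Filter Topology

/-- `(G, v)_{u↓}`: the set of all vertices `w` such that the path from `w` to `v` contains `u`
(in a tree, the subtree hanging from `u` when `G` is rooted at `v`). -/
def subtreeBelow {V : Type*} (G : SimpleGraph V) (v u : V) : Set V :=
  {w | ∃ p : G.Walk w v, p.IsPath ∧ u ∈ p.support}

/-- Jordan centrality `ψ_G(v) = max_{u ≠ v} |(G, v)_{u↓}|` (equal to `0` for a one-vertex graph).
Smaller values mean more central vertices. -/
noncomputable def jordanCentrality {V : Type*} [Fintype V] [DecidableEq V]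
    (G : SimpleGraph V) (v : V) : ℕ :=
  (Finset.univ.erase v).sup fun u => (subtreeBelow G v u).ncard

/-- The Jordan rank of `u`: one plus the number of vertices ranked ahead of `u`. Ties are broken
pessimistically: among vertices of equal centrality, the larger label comes first. -/
noncomputable def jordanRank {V : Type*} [Fintype V] [LinearOrder V]
    (G : SimpleGraph V) (u : V) : ℕ :=
  1 + (Finset.univ.filter fun v => jordanCentrality G v < jordanCentrality G u ∨
      (jordanCentrality G v = jordanCentrality G u ∧ u < v)).card

/-- The tree `T_n` on the vertex set `[n] = {1, …, n}` in which, for every `1 ≤ m < n`, the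
vertex `m + 1` is joined by an edge to the vertex `U m`. -/
def attachmentTree (U : ℕ → ℕ) (n : ℕ) : SimpleGraph (Set.Icc 1 n) :=
  SimpleGraph.fromRel fun a b => ∃ m : ℕ, 1 ≤ m ∧ (a : ℕ) = U m ∧ (b : ℕ) = m + 1

/-- `R_n`: the Jordan rank of the root `1` in `T_n`, for `n ≥ 1` (and `0` for the meaningless
index `n = 0`). -/
noncomputable def rootJordanRank (U : ℕ → ℕ) (n : ℕ) : ℕ :=
  if h : 1 ≤ n then jordanRank (attachmentTree U n) ⟨1, Set.mem_Icc.mpr ⟨le_rfl, h⟩⟩ else 0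

/-- The attachment choices of the uniform random recursive tree: for `n ≥ 1`, the random
vertex `U n` to which the vertex `n + 1` attaches is uniform on `[n]`, and these choices are
independent (so that `U n` is independent of `T_n`). The value `U 0` plays no role. -/
structure IsUniformAttachment {Ω : Type*} [MeasurableSpace Ω] (μ : Measure Ω)
    (U : ℕ → Ω → ℕ) : Prop where
  measurable : ∀ n : ℕ, 1 ≤ n → Measurable (U n)
  uniform : ∀ n : ℕ, 1 ≤ n → μ.map (U n) = uniformOn (Set.Icc 1 n)
  indep : iIndepFun (fun n : ℕ => U (n + 1)) μ

/-! Let D_u be the number of descendants of u at time n. A vertex v ≠ 1 is ranked ahead of the root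
exactly when D_u + D_v ≥ n for some u ≥ 2 (`jordanCentrality_le_iff`), so the rank is a count of
such v (`rootJordanRank_eq`). It stabilizes once only finitely many pairs (u, v) can ever satisfy
the inequality and, for each fixed pair, its truth value is eventually constant.

The counts evolve as Pólya urns. No limit law is needed: each estimate comes from an explicit
nonnegative function of the tree that does not increase on average and is therefore almost surely
bounded (`IsUniformAttachment.ae_bounded`). `complementWeight` keeps n - D_u above a positive
fraction of n; `cubicWeight` makes D_v / n uniformly small for late v. Together they leave finitely
many pairs (`exists_forall_lt_of_le_card_add`).

For a fixed pair u ≤ v, if v is not a descendant of u, the two subtrees are disjoint and miss the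
root, so the inequality always fails. Otherwise D_v is compared with n - D_u. `tieWeight` is of
order √n at a tie, so ties stop; the difference moves by at most one per step, so its sign freezes
(`IsUniformAttachment.ae_eventually_of_le`). -/

/-- The descendants of `v` (including `v` itself) among the vertices `1, …, n` of the recursive
tree in which `m + 1` is attached to `U m`. -/
def descendants (U : ℕ → ℕ) (v : ℕ) : ℕ → Finset ℕ
  | 0 => ∅
  | n + 1 => if n + 1 = v ∨ U n ∈ descendants U v n then insert (n + 1) (descendants U v n)
      else descendants U v n

/-- Every vertex is attached to an earlier one. -/
def IsAttachment (U : ℕ → ℕ) : Prop := ∀ m, 1 ≤ m → 1 ≤ U m ∧ U m ≤ m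

/-! ### Combinatorics of descendant sets. -/

section Descendants

variable {U U' : ℕ → ℕ} {u v w m n : ℕ}

theorem descendants_congr (h : ∀ m, 1 ≤ m → m < n → U m = U' m) :
    descendants U v n = descendants U' v n := by
  induction n with
  | zero => rfl
  | succ n ih =>
    have ih' := ih fun m h1 h2 => h m h1 (by omega)
    rcases Nat.eq_zero_or_pos n with rfl | hn
    · simp [descendants]
    · simp only [descendants, ih', h n hn (by omega)]

theorem descendants_subset_Icc : descendants U v n ⊆ Finset.Icc 1 n := by
  induction n with
  | zero => simp [descendants]
  | succ n ih =>
    intro w hw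
    rw [descendants] at hw
    split_ifs at hw
    · rcases Finset.mem_insert.1 hw with rfl | h
      · simp
      · have := Finset.mem_Icc.1 (ih h)
        exact Finset.mem_Icc.2 ⟨this.1, by omega⟩
    · have := Finset.mem_Icc.1 (ih hw)
      exact Finset.mem_Icc.2 ⟨this.1, by omega⟩

theorem succ_notMem_descendants : n + 1 ∉ descendants U v n := fun h => by
  have := Finset.mem_Icc.1 (descendants_subset_Icc h)
  omega

theorem mem_descendants_succ_of_ne (h : w ≠ n + 1) :
    w ∈ descendants U v (n + 1) ↔ w ∈ descendants U v n := by
  rw [descendants]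
  split_ifs <;> simp [h]

theorem mem_descendants_iff_of_le (hw : w ≤ m) (hm : m ≤ n) :
    w ∈ descendants U v n ↔ w ∈ descendants U v m := by
  induction n, hm using Nat.le_induction with
  | base => rfl
  | succ n hmn ih => rw [mem_descendants_succ_of_ne (by omega), ih]

theorem succ_mem_descendants_succ :
    n + 1 ∈ descendants U v (n + 1) ↔ n + 1 = v ∨ U n ∈ descendants U v n := by
  rw [descendants]
  split_ifs with h
  · simp [h]
  · simp [h, succ_notMem_descendants]

theorem succ_mem_descendants (hU : IsAttachment U) (hm : 1 ≤ m) (hmn : m + 1 ≤ n) :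
    m + 1 ∈ descendants U v n ↔ m + 1 = v ∨ U m ∈ descendants U v n := by
  rw [mem_descendants_iff_of_le le_rfl hmn, succ_mem_descendants_succ,
    mem_descendants_iff_of_le (hU m hm).2 (by omega : m ≤ n)]

theorem descendants_eq_empty (h : n < v) : descendants U v n = ∅ := by
  induction n with
  | zero => rfl
  | succ n ih =>
    rw [descendants, ih (by omega), if_neg (by simp; omega)]

theorem self_mem_descendants (hv : 1 ≤ v) (h : v ≤ n) : v ∈ descendants U v n := by
  obtain ⟨v, rfl⟩ := Nat.exists_eq_add_of_le' hv
  rw [mem_descendants_iff_of_le le_rfl h, succ_mem_descendants_succ]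
  exact Or.inl rfl

theorem descendants_self (hv : 1 ≤ v) : descendants U v v = {v} := by
  obtain ⟨v, rfl⟩ := Nat.exists_eq_add_of_le' hv
  rw [descendants, descendants_eq_empty (by omega)]
  simp

theorem one_notMem_descendants (hv : 2 ≤ v) : 1 ∉ descendants U v n := by
  rcases Nat.eq_zero_or_pos n with rfl | hn
  · simp [descendants]
  · rw [mem_descendants_iff_of_le le_rfl hn, descendants_eq_empty (by omega)]
    simp

theorem card_descendants_succ (h : v ≤ n) :
    (descendants U v (n + 1)).card
      = (descendants U v n).card + if U n ∈ descendants U v n then 1 else 0 := by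
  have h1 : n + 1 ≠ v := by omega
  rw [descendants]
  simp only [h1, false_or]
  split_ifs
  · rw [Finset.card_insert_of_notMem succ_notMem_descendants]
  · rfl

theorem card_descendants_lt (hv : 2 ≤ v) (hn : 1 ≤ n) : (descendants U v n).card < n := by
  have h : descendants U v n ⊂ Finset.Icc 1 n := by
    refine ⟨descendants_subset_Icc, fun h => one_notMem_descendants hv (h ?_)⟩
    simp [hn]
  simpa using Finset.card_lt_card h

theorem card_descendants_pos (hv : 1 ≤ v) (h : v ≤ n) : 1 ≤ (descendants U v n).card :=
  Finset.card_pos.2 ⟨v, self_mem_descendants hv h⟩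

theorem descendants_subset (hv : v ∈ descendants U u v) :
    descendants U v n ⊆ descendants U u n := by
  induction n with
  | zero => simp [descendants]
  | succ n ih =>
    intro w hw
    by_cases hwn : w = n + 1
    · subst hwn
      rcases succ_mem_descendants_succ.1 hw with h | h
      · rw [h]; exact hv
      · exact succ_mem_descendants_succ.2 (Or.inr (ih h))
    · rw [mem_descendants_succ_of_ne hwn] at hw ⊢
      exact ih hw

theorem disjoint_descendants (huv : u ≤ v) (hv : v ∉ descendants U u v) :
    Disjoint (descendants U v n) (descendants U u n) := by
  induction n with
  | zero => simp [descendants]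
  | succ n ih =>
    rw [Finset.disjoint_left] at ih ⊢
    intro w hw hw'
    by_cases hwn : w = n + 1
    · subst hwn
      rcases succ_mem_descendants_succ.1 hw with h | h
      · rw [h] at hw'
        exact hv hw'
      · rcases succ_mem_descendants_succ.1 hw' with h' | h'
        · rw [descendants_eq_empty (by omega)] at h
          simp at h
        · exact ih h h'
    · rw [mem_descendants_succ_of_ne hwn] at hw hw'
      exact ih hw hw'

theorem card_descendants_add_lt_of_notMem (hu : 2 ≤ u) (huv : u ≤ v) (hv : v ∉ descendants U u v)
    (hn : 1 ≤ n) : (descendants U u n).card + (descendants U v n).card < n := by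
  rw [add_comm, ← Finset.card_union_of_disjoint (disjoint_descendants huv hv)]
  have h : descendants U v n ∪ descendants U u n ⊂ Finset.Icc 1 n := by
    refine ⟨Finset.union_subset descendants_subset_Icc descendants_subset_Icc, fun h => ?_⟩
    rcases Finset.mem_union.1 (h (Finset.mem_Icc.2 ⟨le_rfl, hn⟩)) with h | h
    · exact one_notMem_descendants (by omega) h
    · exact one_notMem_descendants hu h
  simpa using Finset.card_lt_card h

end Descendants

/-! ### From paths and Jordan centrality to descendant counts. -/

section Graph

variable {U U' : ℕ → ℕ} {n : ℕ}

theorem attachmentTree_congr (h : ∀ m, 1 ≤ m → U m = U' m) :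
    attachmentTree U n = attachmentTree U' n := by
  unfold attachmentTree
  congr 1
  ext a b
  exact exists_congr fun m => and_congr_right fun hm => by rw [h m hm]

theorem rootJordanRank_congr (h : ∀ m, 1 ≤ m → U m = U' m) :
    rootJordanRank U n = rootJordanRank U' n := by
  unfold rootJordanRank
  rw [attachmentTree_congr h]

theorem mem_descendants_of_adj (hU : IsAttachment U) {v : ℕ} {a b : Set.Icc 1 n}
    (h : (attachmentTree U n).Adj a b) (ha : (a : ℕ) ∈ descendants U v n) (hav : (a : ℕ) ≠ v) :
    (b : ℕ) ∈ descendants U v n := by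
  rw [attachmentTree, SimpleGraph.fromRel_adj] at h
  obtain ⟨-, ⟨m, hm, h1, h2⟩ | ⟨m, hm, h1, h2⟩⟩ := h
  · rw [h2, succ_mem_descendants hU hm (h2 ▸ b.2.2)]
    exact Or.inr (h1 ▸ ha)
  · rw [h2, succ_mem_descendants hU hm (h2 ▸ a.2.2)] at ha
    rw [h1]
    exact ha.resolve_left (h2 ▸ hav)

/-- The edge from `v` to its parent `U (v - 1)` is the only exit from the subtree of `v`. -/
theorem eq_of_adj_of_notMem_descendants (hU : IsAttachment U) {v : ℕ} {a b : Set.Icc 1 n}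
    (h : (attachmentTree U n).Adj a b) (ha : (a : ℕ) ∈ descendants U v n)
    (hb : (b : ℕ) ∉ descendants U v n) : (a : ℕ) = v ∧ (b : ℕ) = U (v - 1) := by
  have hav : (a : ℕ) = v := by
    by_contra hav
    exact hb (mem_descendants_of_adj hU h ha hav)
  refine ⟨hav, ?_⟩
  rw [attachmentTree, SimpleGraph.fromRel_adj] at h
  obtain ⟨-, ⟨m, hm, h1, h2⟩ | ⟨m, hm, h1, h2⟩⟩ := h
  · refine absurd ?_ hb
    rw [h2, succ_mem_descendants hU hm (h2 ▸ b.2.2)]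
    exact Or.inr (h1 ▸ ha)
  · rw [h1, ← hav, h2, Nat.add_sub_cancel]

theorem attachmentTree_reachable_one (hU : IsAttachment U) (hn : 1 ≤ n) (a : Set.Icc 1 n) :
    (attachmentTree U n).Reachable a ⟨1, Set.mem_Icc.mpr ⟨le_rfl, hn⟩⟩ := by
  obtain ⟨a, ha⟩ := a
  induction a using Nat.strong_induction_on with
  | _ a ih =>
    by_cases h1 : a = 1
    · subst h1
      exact SimpleGraph.Reachable.refl _
    · obtain ⟨m, rfl⟩ : ∃ m, a = m + 1 := ⟨a - 1, by have := ha.1; omega⟩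
      have hm : 1 ≤ m := by have := ha.1; omega
      have hp := hU m hm
      have hpn : U m ∈ Set.Icc 1 n := ⟨hp.1, by have := ha.2; omega⟩
      refine SimpleGraph.Reachable.trans (SimpleGraph.Adj.reachable ?_) (ih (U m) (by omega) hpn)
      rw [attachmentTree, SimpleGraph.fromRel_adj]
      refine ⟨fun h => ?_, Or.inr ⟨m, hm, rfl, rfl⟩⟩
      have := congrArg Subtype.val h
      simp at this
      omega

theorem attachmentTree_preconnected (hU : IsAttachment U) : (attachmentTree U n).Preconnected := by
  intro a b
  have hn : 1 ≤ n := a.2.1.trans a.2.2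
  exact (attachmentTree_reachable_one hU hn a).trans (attachmentTree_reachable_one hU hn b).symm

theorem exists_mem_support_of_mem_descendants (hU : IsAttachment U) {v : ℕ} {a b : Set.Icc 1 n}
    (p : (attachmentTree U n).Walk a b) (ha : (a : ℕ) ∈ descendants U v n)
    (hb : (b : ℕ) ∉ descendants U v n) :
    (∃ x ∈ p.support, (x : ℕ) = v) ∧ ∃ x ∈ p.support, (x : ℕ) = U (v - 1) := by
  induction p with
  | nil => exact absurd ha hb
  | @cons a c b h p ih =>
    by_cases hc : (c : ℕ) ∈ descendants U v n
    · obtain ⟨⟨x, hx, hxv⟩, y, hy, hyv⟩ := ih hc hb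
      exact ⟨⟨x, by simp [hx], hxv⟩, y, by simp [hy], hyv⟩
    · obtain ⟨h1, h2⟩ := eq_of_adj_of_notMem_descendants hU h ha hc
      exact ⟨⟨a, by simp, h1⟩, c, by simp, h2⟩

theorem support_subset_descendants (hU : IsAttachment U) {a b : Set.Icc 1 n}
    (p : (attachmentTree U n).Walk a b) (hp : p.IsPath) (ha : (a : ℕ) ∈ descendants U b n) :
    ∀ x ∈ p.support, (x : ℕ) ∈ descendants U b n := by
  induction p with
  | nil => simpa using ha
  | @cons a c b h p ih =>
    rw [SimpleGraph.Walk.cons_isPath_iff] at hp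
    have hab : (a : ℕ) ≠ b := fun hab => hp.2 (by rw [Subtype.ext hab]; exact p.end_mem_support)
    intro x hx
    rw [SimpleGraph.Walk.support_cons, List.mem_cons] at hx
    rcases hx with rfl | hx
    · exact ha
    · exact ih hp.1 (mem_descendants_of_adj hU h ha hab) x hx

/-- A walk that enters the subtree of `u` and comes out again uses the parent of `u` both times, so
it is not a path. -/
theorem notMem_support_of_notMem_descendants (hU : IsAttachment U) {a b u : Set.Icc 1 n}
    (p : (attachmentTree U n).Walk a b) (hp : p.IsPath) (ha : (a : ℕ) ∉ descendants U u n)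
    (hb : (b : ℕ) ∉ descendants U u n) : u ∉ p.support := by
  have hu : (u : ℕ) ∈ descendants U u n := self_mem_descendants u.2.1 u.2.2
  induction p with
  | nil =>
    intro h
    rw [SimpleGraph.Walk.support_nil, List.mem_singleton] at h
    subst h
    exact ha hu
  | @cons a c b h p ih =>
    rw [SimpleGraph.Walk.cons_isPath_iff] at hp
    intro hx
    rw [SimpleGraph.Walk.support_cons, List.mem_cons] at hx
    rcases hx with rfl | hx
    · exact ha hu
    · by_cases hc : (c : ℕ) ∈ descendants U u n
      · obtain ⟨-, h2⟩ := eq_of_adj_of_notMem_descendants hU h.symm hc ha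
        obtain ⟨-, y, hy, hyv⟩ := exists_mem_support_of_mem_descendants hU p hc hb
        exact hp.2 (by rwa [Subtype.ext (h2.trans hyv.symm)])
      · exact ih hp.1 hc hb hx

theorem ncard_coe_mem_finset (s : Finset ℕ) (hs : s ⊆ Finset.Icc 1 n) :
    {w : Set.Icc 1 n | (w : ℕ) ∈ s}.ncard = s.card := by
  rw [← Set.ncard_image_of_injective _ Subtype.val_injective, ← Set.ncard_coe_finset]
  congr 1
  ext w
  constructor
  · rintro ⟨w, hw, rfl⟩
    exact hw
  · intro hw
    have := Finset.mem_Icc.1 (hs hw)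
    exact ⟨⟨w, this.1, this.2⟩, hw, rfl⟩

theorem ncard_descendants (v : ℕ) :
    {w : Set.Icc 1 n | (w : ℕ) ∈ descendants U v n}.ncard = (descendants U v n).card :=
  ncard_coe_mem_finset _ descendants_subset_Icc

theorem ncard_notMem_descendants (v : ℕ) :
    {w : Set.Icc 1 n | (w : ℕ) ∉ descendants U v n}.ncard = n - (descendants U v n).card := by
  have h := ncard_coe_mem_finset (n := n) (Finset.Icc 1 n \ descendants U v n)
    Finset.sdiff_subset
  rw [Finset.card_sdiff_of_subset descendants_subset_Icc, Nat.card_Icc, Nat.add_sub_cancel] at h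
  rw [← h]
  congr 1
  ext w
  simp [w.2.1, w.2.2]

theorem subtreeBelow_subset_descendants (hU : IsAttachment U) {v u : Set.Icc 1 n}
    (hv : (v : ℕ) ∉ descendants U u n) :
    subtreeBelow (attachmentTree U n) v u ⊆ {w | (w : ℕ) ∈ descendants U u n} := by
  rintro w ⟨p, hp, hu⟩
  by_contra hw
  exact notMem_support_of_notMem_descendants hU p hp hw hv hu

theorem subtreeBelow_eq_descendants (hU : IsAttachment U) {v u : Set.Icc 1 n}
    (hv : (v : ℕ) ∉ descendants U u n) :
    subtreeBelow (attachmentTree U n) v u = {w : Set.Icc 1 n | (w : ℕ) ∈ descendants U u n} := by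
  refine (subtreeBelow_subset_descendants hU hv).antisymm fun w hw => ?_
  obtain ⟨p, hp⟩ := (attachmentTree_preconnected hU w v).exists_isPath
  obtain ⟨⟨x, hx, hxu⟩, -⟩ := exists_mem_support_of_mem_descendants hU p hw hv
  exact ⟨p, hp, by rwa [← Subtype.ext hxu]⟩

theorem subtreeBelow_subset_notMem_descendants (hU : IsAttachment U) {v u : Set.Icc 1 n}
    (hu : (u : ℕ) ∉ descendants U v n) :
    subtreeBelow (attachmentTree U n) v u ⊆ {w | (w : ℕ) ∉ descendants U v n} := by
  rintro w ⟨p, hp, hup⟩ hw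
  exact hu (support_subset_descendants hU p hp hw u hup)

theorem notMem_descendants_subset_subtreeBelow (hU : IsAttachment U) {v u : Set.Icc 1 n}
    (hu : (u : ℕ) = U (v - 1)) :
    {w : Set.Icc 1 n | (w : ℕ) ∉ descendants U v n} ⊆ subtreeBelow (attachmentTree U n) v u := by
  intro w hw
  obtain ⟨p, hp⟩ := (attachmentTree_preconnected hU w v).exists_isPath
  obtain ⟨-, x, hx, hxu⟩ := exists_mem_support_of_mem_descendants hU p.reverse
    (self_mem_descendants v.2.1 v.2.2) hw
  refine ⟨p, hp, ?_⟩
  rw [SimpleGraph.Walk.support_reverse, List.mem_reverse] at hx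
  rwa [Subtype.ext (hu.trans hxu.symm)]

theorem jordanCentrality_one (hU : IsAttachment U) (hn : 1 ≤ n) :
    jordanCentrality (attachmentTree U n) ⟨1, Set.mem_Icc.mpr ⟨le_rfl, hn⟩⟩
      = (Finset.univ.erase (⟨1, Set.mem_Icc.mpr ⟨le_rfl, hn⟩⟩ : Set.Icc 1 n)).sup
          fun u => (descendants U u n).card := by
  refine Finset.sup_congr rfl fun u hu => ?_
  have h1 : (u : ℕ) ≠ 1 := fun h => (Finset.mem_erase.1 hu).1 (Subtype.ext h)
  have h2 : 2 ≤ (u : ℕ) := by have := u.2.1; omega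
  rw [subtreeBelow_eq_descendants hU (one_notMem_descendants h2), ncard_descendants]

/-- Seen from `v`, the branch at its parent consists of all non-descendants of `v` and contains
every other branch outside the subtree. A branch inside the subtree is also a branch seen from the
root, so it never exceeds the root's centrality. Only n - D_v has to be compared with max D_u. -/
theorem jordanCentrality_le_iff (hU : IsAttachment U) (hn : 1 ≤ n) {v : Set.Icc 1 n}
    (hv : (v : ℕ) ≠ 1) :
    jordanCentrality (attachmentTree U n) v
        ≤ jordanCentrality (attachmentTree U n) ⟨1, Set.mem_Icc.mpr ⟨le_rfl, hn⟩⟩ ↔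
      ∃ u ∈ Finset.Icc 2 n, n ≤ (descendants U u n).card + (descendants U v n).card := by
  rw [jordanCentrality_one hU hn]
  have hv2 : 2 ≤ (v : ℕ) := by have := v.2.1; omega
  constructor
  · intro h
    have hp := hU (v - 1) (by omega)
    let u : Set.Icc 1 n := ⟨U (v - 1), hp.1, by have := v.2.2; omega⟩
    have huv : u ≠ v := fun h => by
      have : U (v - 1) = (v : ℕ) := congrArg Subtype.val h
      omega
    have h1 : n - (descendants U v n).card ≤ jordanCentrality (attachmentTree U n) v := by
      rw [← ncard_notMem_descendants]
      refine (Set.ncard_le_ncard (notMem_descendants_subset_subtreeBelow (u := u) hU rfl)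
        (Set.toFinite _)).trans ?_
      exact Finset.le_sup (f := fun u => (subtreeBelow (attachmentTree U n) v u).ncard)
        (by simp [huv])
    obtain ⟨w, hw, hw'⟩ := Finset.exists_mem_eq_sup
      (Finset.univ.erase (⟨1, Set.mem_Icc.mpr ⟨le_rfl, hn⟩⟩ : Set.Icc 1 n))
      ⟨v, by simpa [Subtype.ext_iff] using hv⟩ fun u => (descendants U u n).card
    rw [hw'] at h
    have hw1 : (w : ℕ) ≠ 1 := fun h => (Finset.mem_erase.1 hw).1 (Subtype.ext h)
    refine ⟨w, Finset.mem_Icc.2 ⟨by have := w.2.1; omega, w.2.2⟩, ?_⟩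
    have := h1.trans h
    omega
  · rintro ⟨w, hw, h⟩
    rw [Finset.mem_Icc] at hw
    refine Finset.sup_le fun u hu => ?_
    by_cases hud : (u : ℕ) ∈ descendants U v n
    · have huv : (u : ℕ) ≠ v := fun h => (Finset.mem_erase.1 hu).1 (Subtype.ext h)
      have hu1 : (u : ℕ) ≠ 1 := fun h => one_notMem_descendants hv2 (h ▸ hud)
      have hvu : (v : ℕ) ∉ descendants U u n := fun hvu => by
        have h1 : (v : ℕ) ≤ u := by
          by_contra hlt
          rw [mem_descendants_iff_of_le le_rfl u.2.2, descendants_eq_empty (by omega)] at hud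
          simp at hud
        have h2 : (u : ℕ) ≤ v := by
          by_contra hlt
          rw [mem_descendants_iff_of_le le_rfl v.2.2, descendants_eq_empty (by omega)] at hvu
          simp at hvu
        omega
      rw [subtreeBelow_eq_descendants hU hvu, ncard_descendants]
      exact Finset.le_sup (f := fun u : Set.Icc 1 n => (descendants U u n).card)
        (by simpa [Subtype.ext_iff] using hu1)
    · calc (subtreeBelow (attachmentTree U n) v u).ncard
          ≤ n - (descendants U v n).card := by
            rw [← ncard_notMem_descendants]
            exact Set.ncard_le_ncard (subtreeBelow_subset_notMem_descendants hU hud)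
              (Set.toFinite _)
        _ ≤ (descendants U w n).card := by omega
        _ ≤ _ := Finset.le_sup (f := fun u : Set.Icc 1 n => (descendants U u n).card)
            (b := ⟨w, by omega, hw.2⟩) (by simp [Subtype.ext_iff]; omega)

open Classical in
/-- The root's Jordan rank in terms of the numbers of descendants. -/
theorem rootJordanRank_eq (hU : IsAttachment U) (hn : 1 ≤ n) :
    rootJordanRank U n = 1 + ((Finset.Icc 2 n).filter fun v : ℕ => ∃ u ∈ Finset.Icc 2 n,
      n ≤ (descendants U u n).card + (descendants U v n).card).card := by
  rw [rootJordanRank, dif_pos hn, jordanRank]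
  congr 1
  refine Finset.card_bij (fun v _ => (v : ℕ)) ?_ (fun _ _ _ _ h => Subtype.ext h) ?_
  · intro v hv
    replace hv := (Finset.mem_filter.1 hv).2
    have hv1 : (v : ℕ) ≠ 1 := by
      intro h
      have hv' : v = ⟨1, Set.mem_Icc.mpr ⟨le_rfl, hn⟩⟩ := Subtype.ext h
      rw [← hv'] at hv
      simp at hv
    simp only [Finset.mem_filter]
    refine ⟨Finset.mem_Icc.2 ⟨by have := v.2.1; omega, v.2.2⟩, ?_⟩
    -- Every other label exceeds 1, so ties always count against the root and the ranking condition
    -- is `≤`.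
    rw [← jordanCentrality_le_iff hU hn hv1]
    exact hv.elim le_of_lt fun h => h.1.le
  · intro v hv
    simp only [Finset.mem_filter] at hv
    have hvn := Finset.mem_Icc.1 hv.1
    refine ⟨⟨v, by omega, hvn.2⟩, ?_, rfl⟩
    refine Finset.mem_filter.2 ⟨Finset.mem_univ _, ?_⟩
    have h := (jordanCentrality_le_iff hU hn (v := ⟨v, by omega, hvn.2⟩)
      (by simp; omega)).2 hv.2
    rcases h.lt_or_eq with h | h
    · exact Or.inl h
    · exact Or.inr ⟨h, show 1 < v by omega⟩

end Graph

/-! ### Bounded supermartingales built from the growing tree. -/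

section Supermartingale

variable {Ω : Type*} {mΩ : MeasurableSpace Ω} {μ : Measure Ω}

/-- Nonnegativity turns decreasing expectations into an L¹ bound, so the negated process converges
almost surely, and convergent sequences are bounded. -/
theorem MeasureTheory.Supermartingale.ae_bddAbove_of_nonneg [IsFiniteMeasure μ]
    {𝓕 : Filtration ℕ mΩ} {f : ℕ → Ω → ℝ} (hf : Supermartingale f 𝓕 μ)
    (h0 : ∀ n ω, 0 ≤ f n ω) : ∀ᵐ ω ∂μ, ∃ C, ∀ n, f n ω ≤ C := by
  have hbdd : ∀ n, eLpNorm ((-f) n) 1 μ ≤ ((∫ ω, f 0 ω ∂μ).toNNReal : ENNReal) := by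
    intro n
    rw [Pi.neg_apply, eLpNorm_neg, eLpNorm_one_eq_lintegral_enorm,
      ← ofReal_integral_norm_eq_lintegral_enorm (hf.integrable n)]
    refine ENNReal.ofReal_le_ofReal ?_
    have h1 := hf.setIntegral_le (Nat.zero_le n) MeasurableSet.univ
    rw [setIntegral_univ, setIntegral_univ] at h1
    refine le_trans (le_of_eq (integral_congr_ae (ae_of_all _ fun ω => ?_))) h1
    exact Real.norm_of_nonneg (h0 n ω)
  filter_upwards [hf.neg.exists_ae_tendsto_of_bdd hbdd] with ω ⟨c, hc⟩
  obtain ⟨C, hC⟩ := hc.neg.bddAbove_range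
  exact ⟨C, fun n => by simpa using hC ⟨n, rfl⟩⟩

/-- The choices `U 1, …, U (n - 1)` determine the value of `φ`. -/
def DependsOnChoices {β : Type*} (φ : (ℕ → ℕ) → β) (n : ℕ) : Prop :=
  DependsOn φ {m | 1 ≤ m ∧ m < n}

theorem dependsOnChoices_descendants (v n : ℕ) :
    DependsOnChoices (fun U => descendants U v n) n :=
  fun _ _ h => descendants_congr fun m h1 h2 => h m ⟨h1, h2⟩

theorem descendants_update (U : ℕ → ℕ) (v n k : ℕ) :
    descendants (Function.update U n k) v n = descendants U v n :=
  descendants_congr fun _ _ h2 => Function.update_of_ne h2.ne _ _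

/-- The value of `φ` as a function of the finitely many choices on which it depends. -/
def finiteChoices {β : Type*} (φ : (ℕ → ℕ) → β) (i : ℕ) (x : Fin (i + 1) → ℕ) : β :=
  φ fun m => if h : 1 ≤ m ∧ m < i + 2 then x ⟨m - 1, by omega⟩ else 0

theorem DependsOnChoices.eq_finiteChoices {β : Type*} {φ : (ℕ → ℕ) → β} {i : ℕ}
    (hφ : DependsOnChoices φ (i + 2)) (U : ℕ → ℕ) :
    φ U = finiteChoices φ i fun j => U (j + 1) := by
  refine hφ fun m hm => ?_
  have h : 1 ≤ m ∧ m < i + 2 := hm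
  simp only [h, and_self, dite_true]
  rw [Nat.sub_add_cancel h.1]

theorem IsAttachment.update {V : ℕ → ℕ} (hV : IsAttachment V) {n k : ℕ} (hk : 1 ≤ k ∧ k ≤ n) :
    IsAttachment (Function.update V n k) := by
  intro m hm
  by_cases h : m = n
  · subst h
    simpa using hk
  · rw [Function.update_of_ne h]
    exact hV m hm

variable {U : ℕ → Ω → ℕ}

/-- The filtration in which stage `i` knows the tree with `i + 2` vertices. -/
def IsUniformAttachment.filtration (hU : IsUniformAttachment μ U) : Filtration ℕ mΩ :=
  Filtration.natural (fun n => U (n + 1))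
    fun n => (hU.measurable (n + 1) (by omega)).stronglyMeasurable

theorem IsUniformAttachment.measurable_filtration (hU : IsUniformAttachment μ U)
    {β : Type*} [MeasurableSpace β] {φ : (ℕ → ℕ) → β} {i : ℕ}
    (hφ : DependsOnChoices φ (i + 2)) :
    Measurable[hU.filtration i] fun ω => φ fun m => U m ω := by
  have h1 : Measurable[hU.filtration i] fun ω (j : Fin (i + 1)) => U (j + 1) ω := by
    refine @measurable_pi_lambda _ _ _ (hU.filtration i) _ _ fun j => ?_
    have h := Filtration.stronglyAdapted_natural (u := fun n => U (n + 1))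
      fun n => (hU.measurable (n + 1) (by omega)).stronglyMeasurable
    exact ((h j).measurable).mono (hU.filtration.mono (by omega)) le_rfl
  have h2 : Measurable (finiteChoices φ i) := Measurable.of_discrete
  convert h2.comp h1 using 1
  ext ω
  exact hφ.eq_finiteChoices _

/-- There are only finitely many attachment histories of a given length. This gives integrability of
every weight with no estimate. -/
theorem DependsOnChoices.exists_bound {φ : (ℕ → ℕ) → ℝ} {i : ℕ}
    (hφ : DependsOnChoices φ (i + 2)) :
    ∃ C, ∀ U, IsAttachment U → |φ U| ≤ C := by
  have hfin : (Set.pi Set.univ fun j : Fin (i + 1) => Set.Icc 1 ((j : ℕ) + 1)).Finite :=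
    Set.Finite.pi fun j => Set.finite_Icc _ _
  obtain ⟨C, hC⟩ := (hfin.image fun x => |finiteChoices φ i x|).bddAbove
  refine ⟨C, fun U hU => hC ⟨fun j => U (j + 1), fun j _ => ?_, ?_⟩⟩
  · exact hU (j + 1) (by omega)
  · simp only [hφ.eq_finiteChoices U]

theorem IsUniformAttachment.integrable [IsFiniteMeasure μ] (hU : IsUniformAttachment μ U)
    (hatt : ∀ ω, IsAttachment fun m => U m ω) {φ : (ℕ → ℕ) → ℝ} {i : ℕ}
    (hφ : DependsOnChoices φ (i + 2)) : Integrable (fun ω => φ fun m => U m ω) μ := by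
  obtain ⟨C, hC⟩ := hφ.exists_bound
  refine Integrable.of_bound (C := C) ?_ (ae_of_all _ fun ω => hC _ (hatt ω))
  exact ((hU.measurable_filtration hφ).mono (hU.filtration.le i) le_rfl).aestronglyMeasurable

theorem IsUniformAttachment.measureReal_eq (hU : IsUniformAttachment μ U) {n k : ℕ}
    (hk : k ∈ Finset.Icc 1 n) : μ.real (U n ⁻¹' {k}) = 1 / n := by
  have hn : 1 ≤ n := by
    have := Finset.mem_Icc.1 hk
    omega
  have h := hU.uniform n hn
  have h1 : μ (U n ⁻¹' {k}) = uniformOn (Set.Icc 1 n) {k} := by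
    rw [← h, Measure.map_apply (hU.measurable n hn) (measurableSet_singleton k)]
  have h2 := uniformOn_apply_finset (s := Finset.Icc 1 n) (t := {k})
  rw [Finset.coe_Icc, Finset.coe_singleton, Finset.inter_singleton_of_mem hk] at h2
  rw [Measure.real, h1, h2]
  simp

/-- Averaging over the last choice. -/
theorem IsUniformAttachment.setIntegral_succ [IsProbabilityMeasure μ]
    (hU : IsUniformAttachment μ U)
    (hatt : ∀ ω, IsAttachment fun m => U m ω) {φ : (ℕ → ℕ) → ℝ} {i : ℕ}
    (hφ : DependsOnChoices φ (i + 3)) {s : Set Ω} (hs : MeasurableSet[hU.filtration i] s) :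
    ∫ ω in s, φ (fun m => U m ω) ∂μ
      = ∫ ω in s, (∑ k ∈ Finset.Icc 1 (i + 2),
          φ (Function.update (fun m => U m ω) (i + 2) k)) / (i + 2 : ℕ) ∂μ := by
  have hs' : MeasurableSet s := hU.filtration.le i s hs
  have hφk : ∀ k, DependsOnChoices (fun V => φ (Function.update V (i + 2) k)) (i + 2) := by
    intro k x y hxy
    refine hφ fun m hm => ?_
    by_cases hmi : m = i + 2
    · subst hmi; simp
    · rw [Function.update_of_ne hmi, Function.update_of_ne hmi]
      have hm' : 1 ≤ m ∧ m < i + 3 := hm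
      exact hxy m ⟨hm'.1, by omega⟩
  have hint : ∀ k, Integrable (fun ω => φ (Function.update (fun m => U m ω) (i + 2) k)) μ :=
    fun k => hU.integrable hatt (hφk k)
  have hUm : Measurable (U (i + 2)) := hU.measurable (i + 2) (by omega)
  have hk : ∀ k ∈ Finset.Icc 1 (i + 2),
      ∫ ω in s, φ (Function.update (fun m => U m ω) (i + 2) k)
          * (U (i + 2) ⁻¹' {k}).indicator 1 ω ∂μ
        = (∫ ω in s, φ (Function.update (fun m => U m ω) (i + 2) k) ∂μ) * (1 / (i + 2 : ℕ)) := by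
    intro k hk
    have hmeas : Measurable[hU.filtration i]
        (s.indicator fun ω => φ (Function.update (fun m => U m ω) (i + 2) k)) :=
      Measurable.indicator (hU.measurable_filtration (hφk k)) hs
    have hmeas' : Measurable[MeasurableSpace.comap (U (i + 2)) inferInstance]
        ((U (i + 2) ⁻¹' {k}).indicator (1 : Ω → ℝ)) :=
      (@measurable_const ℝ Ω _ (MeasurableSpace.comap (U (i + 2)) inferInstance) 1).indicator
        (MeasurableSpace.measurableSet_comap.2 ⟨{k}, measurableSet_singleton k, rfl⟩)
    -- With the last choice frozen at `k`, the first factor is known at stage `i`, while the event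
    -- concerns only the fresh choice.
    have hind : IndepFun (s.indicator fun ω => φ (Function.update (fun m => U m ω) (i + 2) k))
        ((U (i + 2) ⁻¹' {k}).indicator (1 : Ω → ℝ)) μ := by
      rw [IndepFun_iff_Indep]
      have h : Indep (MeasurableSpace.comap (U (i + 2)) inferInstance) (hU.filtration i) μ := by
        have h := indep_iSup_of_disjoint
          (fun n => (hU.measurable (n + 1) (by omega)).comap_le) hU.indep
          (S := {i + 1}) (T := {k | k ≤ i}) (by simp)
        rwa [iSup_singleton] at h
      exact indep_of_indep_of_le_left (indep_of_indep_of_le_right h.symm hmeas'.comap_le)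
        hmeas.comap_le
    rw [← integral_indicator hs', ← integral_indicator hs', ← hU.measureReal_eq hk,
      ← integral_indicator_one (hUm (measurableSet_singleton k)),
      ← hind.integral_fun_mul_eq_mul_integral
        (hmeas.mono (hU.filtration.le i) le_rfl).aestronglyMeasurable
        (hmeas'.mono hUm.comap_le le_rfl).aestronglyMeasurable]
    congr 1
    ext ω
    by_cases hω : ω ∈ s <;> simp [hω]
  have hsum : ∀ ω, φ (fun m => U m ω) = ∑ k ∈ Finset.Icc 1 (i + 2),
      φ (Function.update (fun m => U m ω) (i + 2) k) * (U (i + 2) ⁻¹' {k}).indicator 1 ω := by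
    intro ω
    rw [Finset.sum_eq_single (U (i + 2) ω)]
    · simp only [Set.mem_preimage, Set.mem_singleton_iff, Set.indicator_of_mem, Pi.one_apply,
        mul_one]
      rw [Function.update_eq_self_iff.2 rfl]
    · intro k _ hk
      simp [Set.indicator, hk.symm]
    · intro h
      exact absurd (Finset.mem_Icc.2 (hatt ω (i + 2) (by omega))) h
  simp_rw [hsum]
  rw [integral_finsetSum, Finset.sum_congr rfl hk, ← Finset.sum_mul,
    ← integral_finsetSum _ fun k _ => (hint k).integrableOn, ← integral_mul_const]
  · simp only [div_eq_mul_inv, one_mul]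
  · intro k _
    refine Integrable.integrableOn ?_
    have : (fun ω => φ (Function.update (fun m => U m ω) (i + 2) k)
        * (U (i + 2) ⁻¹' {k}).indicator 1 ω) = (U (i + 2) ⁻¹' {k}).indicator
          fun ω => φ (Function.update (fun m => U m ω) (i + 2) k) := by
      ext ω
      by_cases hω : U (i + 2) ω = k <;> simp [Set.indicator, hω]
    rw [this]
    exact (hint k).indicator (hUm (measurableSet_singleton k))

/-- A nonnegative function of the growing tree which does not increase on average is almost
surely bounded. -/
theorem IsUniformAttachment.ae_bounded [IsProbabilityMeasure μ] (hU : IsUniformAttachment μ U)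
    (hatt : ∀ ω, IsAttachment fun m => U m ω) {φ : ℕ → (ℕ → ℕ) → ℝ} {n₀ : ℕ} (hn₀ : 2 ≤ n₀)
    (hφ : ∀ n, DependsOnChoices (φ n) n)
    (h0 : ∀ n, n₀ ≤ n → ∀ V, IsAttachment V → 0 ≤ φ n V)
    (hle : ∀ n, n₀ ≤ n → ∀ V, IsAttachment V →
      ∑ k ∈ Finset.Icc 1 n, φ (n + 1) (Function.update V n k) ≤ n * φ n V) :
    ∀ᵐ ω ∂μ, ∃ C, ∀ n, n₀ ≤ n → φ n (fun m => U m ω) ≤ C := by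
  obtain ⟨i₀, rfl⟩ := Nat.exists_eq_add_of_le' hn₀
  -- Time is shifted because the supermartingale inequality is available only from `n₀ = i₀ + 2` on.
  let 𝓖 : Filtration ℕ mΩ :=
    { seq := fun i => hU.filtration (i + i₀)
      mono' := fun i j hij => hU.filtration.mono (by omega)
      le' := fun i => hU.filtration.le _ }
  have hsup : Supermartingale (fun i ω => φ (i + i₀ + 2) fun m => U m ω) 𝓖 μ := by
    refine supermartingale_of_setIntegral_succ_le (fun i => ?_) (fun i => ?_) fun i s hs => ?_
    · exact (hU.measurable_filtration (hφ (i + i₀ + 2))).stronglyMeasurable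
    · exact hU.integrable hatt (hφ (i + i₀ + 2))
    · have h1 : i + 1 + i₀ + 2 = i + i₀ + 3 := by ring
      have hs1 : MeasurableSet[hU.filtration (i + i₀)] s := hs
      rw [h1, hU.setIntegral_succ hatt (hφ (i + i₀ + 3)) hs1]
      refine integral_mono_of_nonneg (ae_of_all _ fun ω => ?_)
        (hU.integrable hatt (hφ (i + i₀ + 2))).integrableOn (ae_of_all _ fun ω => ?_)
      · refine div_nonneg (Finset.sum_nonneg fun k hk => ?_) (Nat.cast_nonneg _)
        exact h0 _ (by omega) _ ((hatt ω).update (Finset.mem_Icc.1 hk))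
      · simp only
        rw [div_le_iff₀ (by positivity), mul_comm]
        exact hle (i + i₀ + 2) (by omega) _ (hatt ω)
  filter_upwards [hsup.ae_bddAbove_of_nonneg fun i ω => h0 _ (by omega) _ (hatt ω)]
    with ω ⟨C, hC⟩
  refine ⟨C, fun n hn => ?_⟩
  obtain ⟨i, rfl⟩ := Nat.exists_eq_add_of_le' hn
  exact hC i

end Supermartingale

/-! ### Central binomial estimates and the tie density. -/

section Harmonic

/-- The normalized central binomial coefficient. -/
noncomputable def centralBinomRatio (j : ℕ) : ℝ := j.centralBinom / 4 ^ j

theorem centralBinomRatio_pos (j : ℕ) : 0 < centralBinomRatio j := by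
  have := Nat.centralBinom_pos j
  unfold centralBinomRatio
  positivity

theorem centralBinomRatio_succ (j : ℕ) :
    centralBinomRatio (j + 1) = centralBinomRatio j * ((2 * j + 1) / (2 * j + 2)) := by
  have h : ((j : ℝ) + 1) * (j + 1).centralBinom = 2 * (2 * j + 1) * j.centralBinom := by
    exact_mod_cast Nat.succ_mul_centralBinom_succ j
  unfold centralBinomRatio
  rw [pow_succ]
  field_simp
  linear_combination 2 * h

/-- The left side decreases in `j`, while that of the companion bound with `4 * j + 1` increases;
together they express that the ratio has order j^(-1/2). -/
theorem mul_sq_centralBinomRatio_le (j : ℕ) : (j + 1) * centralBinomRatio j ^ 2 ≤ 1 := by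
  induction j with
  | zero => simp [centralBinomRatio]
  | succ j ih =>
    refine le_trans ?_ ih
    rw [centralBinomRatio_succ, mul_pow, mul_left_comm, mul_comm,
      mul_comm ((j : ℝ) + 1), mul_comm]
    refine mul_le_mul_of_nonneg_left ?_ (sq_nonneg _)
    push_cast
    rw [div_pow, ← mul_div_assoc, div_le_iff₀ (by positivity)]
    nlinarith [Nat.cast_nonneg (α := ℝ) j]

theorem one_le_mul_sq_centralBinomRatio (j : ℕ) : 1 ≤ (4 * j + 1) * centralBinomRatio j ^ 2 := by
  induction j with
  | zero => simp [centralBinomRatio]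
  | succ j ih =>
    refine ih.trans ?_
    rw [centralBinomRatio_succ, mul_pow, mul_left_comm, mul_comm]
    refine mul_le_mul_of_nonneg_left ?_ (sq_nonneg _)
    push_cast
    rw [div_pow, ← mul_div_assoc, le_div_iff₀ (by positivity)]
    nlinarith [Nat.cast_nonneg (α := ℝ) j]

/-- In a two-colour Pólya urn with `a + 1` and `b + 1` balls, the density at `1 / 2` of the
limiting proportion, up to a constant factor. -/
noncomputable def tieDensity (a b : ℕ) : ℝ :=
  (a + b + 1).factorial / (a.factorial * b.factorial * 2 ^ (a + b))

theorem tieDensity_nonneg (a b : ℕ) : 0 ≤ tieDensity a b := by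
  unfold tieDensity
  positivity

/-- The conditional density at 1/2 is the average of its values after the next draw from `a + 1` and
`b + 1` balls. -/
theorem tieDensity_harmonic (a b : ℕ) :
    (a + 1) * tieDensity (a + 1) b + (b + 1) * tieDensity a (b + 1)
      = (a + b + 2) * tieDensity a b := by
  have h1 : a + 1 + b + 1 = (a + b + 1) + 1 := by ring
  have h2 : a + (b + 1) + 1 = (a + b + 1) + 1 := by ring
  have h3 : a + 1 + b = a + b + 1 := by ring
  have h4 : a + (b + 1) = a + b + 1 := by ring
  unfold tieDensity
  rw [h1, h2, h3, h4, Nat.factorial_succ (a + b + 1), Nat.factorial_succ a, Nat.factorial_succ b,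
    pow_succ]
  have := Nat.factorial_ne_zero a
  have := Nat.factorial_ne_zero b
  push_cast
  field_simp
  ring

theorem tieDensity_self (a : ℕ) : tieDensity a a = (2 * a + 1) * centralBinomRatio a := by
  have h := Nat.choose_mul_factorial_mul_factorial (show a ≤ 2 * a by omega)
  rw [show 2 * a - a = a by omega, ← Nat.centralBinom_eq_two_mul_choose] at h
  have h' : (a.centralBinom : ℝ) * a.factorial * a.factorial = (2 * a).factorial := by
    exact_mod_cast h
  unfold tieDensity centralBinomRatio
  rw [← two_mul, Nat.factorial_succ, pow_mul]
  have := Nat.factorial_ne_zero a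
  push_cast
  rw [← h']
  field_simp
  norm_num

theorem le_sq_tieDensity_self (a : ℕ) : (a : ℝ) ≤ tieDensity a a ^ 2 := by
  have h := one_le_mul_sq_centralBinomRatio a
  have h0 : (0 : ℝ) ≤ a := Nat.cast_nonneg a
  rw [tieDensity_self, mul_pow]
  nlinarith [sq_nonneg (centralBinomRatio a)]

end Harmonic

/-! ### Three weights that do not increase on average. -/

section Urns

variable {V : ℕ → ℕ} {u v n k : ℕ}

theorem card_descendants_update_succ (h : v ≤ n) :
    (descendants (Function.update V n k) v (n + 1)).card
      = (descendants V v n).card + if k ∈ descendants V v n then 1 else 0 := by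
  rw [card_descendants_succ h, descendants_update, Function.update_self]

theorem sum_ite_mem_Icc {s : Finset ℕ} (hs : s ⊆ Finset.Icc 1 n) (a b : ℝ) :
    ∑ k ∈ Finset.Icc 1 n, (if k ∈ s then a else b) = s.card * a + (n - s.card) * b := by
  have h : ∀ k, (if k ∈ s then a else b) = (if k ∈ s then a - b else 0) + b := fun k => by
    split_ifs <;> ring
  simp_rw [h]
  rw [Finset.sum_add_distrib, Finset.sum_ite_mem, Finset.inter_eq_right.2 hs]
  simp
  ring

/-- Decreases on average; boundedness forces the complement of the descendants to have positive
density. -/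
noncomputable def complementWeight (u n : ℕ) (V : ℕ → ℕ) : ℝ :=
  centralBinomRatio (n - (descendants V u n).card - 1) / centralBinomRatio (n - 1)

/-- The weight is the conditional moment of order -1/2 of the limiting proportion of
non-descendants, so equality holds. -/
theorem sum_complementWeight_le (hu : 2 ≤ u) (hn : u ≤ n) :
    ∑ k ∈ Finset.Icc 1 n, complementWeight u (n + 1) (Function.update V n k)
      ≤ n * complementWeight u n V := by
  have hlt : (descendants V u n).card < n := card_descendants_lt hu (by omega)
  have h : ∀ k, complementWeight u (n + 1) (Function.update V n k)
      = if k ∈ descendants V u n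
        then centralBinomRatio (n - (descendants V u n).card - 1) / centralBinomRatio n
        else centralBinomRatio (n - (descendants V u n).card) / centralBinomRatio n := by
    intro k
    unfold complementWeight
    rw [card_descendants_update_succ hn]
    split_ifs
    · rw [Nat.add_sub_cancel, Nat.add_sub_add_right]
    · rw [Nat.add_sub_cancel,
        show n + 1 - ((descendants V u n).card + 0) - 1 = n - (descendants V u n).card by omega]
  simp_rw [h]
  rw [sum_ite_mem_Icc descendants_subset_Icc]
  unfold complementWeight
  generalize (descendants V u n).card = s at hlt
  obtain ⟨j, rfl⟩ : ∃ j, n = s + j + 1 := ⟨n - s - 1, by omega⟩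
  rw [show s + j + 1 - s = j + 1 by omega, Nat.add_sub_cancel, Nat.add_sub_cancel,
    centralBinomRatio_succ j, centralBinomRatio_succ (s + j)]
  have h1 := (centralBinomRatio_pos (s + j)).ne'
  refine le_of_eq ?_
  have h2 : (2 * ((s : ℝ) + j) + 1) ≠ 0 := by positivity
  push_cast
  field_simp
  ring

/-- Up to a constant factor and for `s` balls of one colour in a Pólya urn with `n` balls, the
conditional third moment of the limiting proportion. -/
noncomputable def cubicTerm (v s n : ℕ) : ℝ :=
  v * ((s : ℝ) * (s + 1) * (s + 2)) / ((n : ℝ) * (n + 1) * (n + 2))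

theorem cubicTerm_nonneg (v s n : ℕ) : 0 ≤ cubicTerm v s n := by
  unfold cubicTerm
  positivity

theorem cubicTerm_harmonic (v s : ℕ) (hn : 1 ≤ n) :
    s * cubicTerm v (s + 1) (n + 1) + (n - s) * cubicTerm v s (n + 1) = n * cubicTerm v s n := by
  have hn0 : (0 : ℝ) < n := by positivity
  unfold cubicTerm
  push_cast
  field_simp
  ring

/-- Decreases on average; boundedness forces late vertices to have few descendants. -/
noncomputable def cubicWeight (n : ℕ) (V : ℕ → ℕ) : ℝ :=
  ∑ v ∈ Finset.Icc 2 n, cubicTerm v (descendants V v n).card n + 6 / ((n : ℝ) + 2)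

theorem cubicWeight_nonneg : 0 ≤ cubicWeight n V :=
  add_nonneg (Finset.sum_nonneg fun _ _ => cubicTerm_nonneg _ _ _) (by positivity)

/-- Since D_v / n has typical size 1/v, its cube times v is summable in v, yet the factor v still
penalizes a late vertex with a large share. The newcomer contributes 6/((n+2)(n+3)), which the drop
of 6/(n+2) to 6/(n+3) pays for. -/
theorem sum_cubicWeight_le (hn : 2 ≤ n) :
    ∑ k ∈ Finset.Icc 1 n, cubicWeight (n + 1) (Function.update V n k) ≤ n * cubicWeight n V := by
  have h : ∀ v ∈ Finset.Icc 2 n, ∀ k,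
      cubicTerm v (descendants (Function.update V n k) v (n + 1)).card (n + 1)
      = if k ∈ descendants V v n then cubicTerm v ((descendants V v n).card + 1) (n + 1)
        else cubicTerm v (descendants V v n).card (n + 1) := by
    intro v hv k
    rw [card_descendants_update_succ (Finset.mem_Icc.1 hv).2]
    split_ifs <;> rfl
  unfold cubicWeight
  rw [Finset.sum_add_distrib, Finset.sum_comm, Finset.sum_Icc_succ_top (by omega), mul_add,
    Finset.mul_sum, Finset.sum_congr rfl fun v hv => Finset.sum_congr rfl fun k _ => h v hv k]
  simp_rw [sum_ite_mem_Icc descendants_subset_Icc, descendants_self (Nat.succ_pos n)]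
  rw [add_assoc]
  refine le_of_eq (congrArg₂ _ (Finset.sum_congr rfl fun v _ => ?_) ?_)
  · exact cubicTerm_harmonic _ _ (by omega)
  · simp only [Finset.card_singleton, cubicTerm, Finset.sum_const, Nat.card_Icc, nsmul_eq_mul,
      Nat.add_sub_cancel]
    push_cast
    field_simp
    ring

/-- Preserved on average; it is large whenever the number of descendants of `v` is large and equal
to the number of non-descendants of `u`. -/
noncomputable def tieWeight (u v n : ℕ) (V : ℕ → ℕ) : ℝ :=
  if v ∈ descendants V u n then
    tieDensity ((descendants V v n).card - 1) (n - (descendants V u n).card - 1) else 0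

theorem tieWeight_nonneg : 0 ≤ tieWeight u v n V := by
  unfold tieWeight
  split_ifs
  · exact tieDensity_nonneg _ _
  · exact le_rfl

theorem sum_tieWeight_le (hu : 2 ≤ u) (huv : u ≤ v) (hn : v ≤ n) :
    ∑ k ∈ Finset.Icc 1 n, tieWeight u v (n + 1) (Function.update V n k)
      ≤ n * tieWeight u v n V := by
  have hmem : ∀ k, v ∈ descendants (Function.update V n k) u (n + 1) ↔ v ∈ descendants V u n :=
    fun k => by rw [mem_descendants_succ_of_ne (by omega), descendants_update]
  by_cases hv : v ∈ descendants V u n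
  · have hlt : (descendants V u n).card < n := card_descendants_lt hu (by omega)
    have hpos : 1 ≤ (descendants V v n).card := card_descendants_pos (by omega) hn
    have hsub : descendants V v n ⊆ descendants V u n :=
      descendants_subset ((mem_descendants_iff_of_le le_rfl hn).1 hv)
    have hle := Finset.card_le_card hsub
    obtain ⟨a, ha⟩ : ∃ a, (descendants V v n).card = a + 1 := ⟨_, (Nat.sub_add_cancel hpos).symm⟩
    obtain ⟨b, hb⟩ : ∃ b, n = (descendants V u n).card + b + 1 :=
      ⟨n - (descendants V u n).card - 1, by omega⟩
    -- The urn has three colours: below `v`, below `u` but not `v`, and outside `u`. A draw of the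
    -- middle colour changes neither `a` nor `b`.
    have h : ∀ k, tieWeight u v (n + 1) (Function.update V n k)
        = (if k ∈ descendants V v n then tieDensity (a + 1) b - tieDensity a b else 0)
          + if k ∈ descendants V u n then tieDensity a b else tieDensity a (b + 1) := by
      intro k
      unfold tieWeight
      rw [if_pos ((hmem k).2 hv), card_descendants_update_succ hn,
        card_descendants_update_succ (huv.trans hn), ha]
      by_cases hk : k ∈ descendants V v n
      · rw [if_pos hk, if_pos (hsub hk), if_pos hk, if_pos (hsub hk)]
        rw [show n + 1 - ((descendants V u n).card + 1) - 1 = b by omega]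
        simp
      · rw [if_neg hk, if_neg hk]
        split_ifs
        · rw [show n + 1 - ((descendants V u n).card + 1) - 1 = b by omega]
          simp
        · rw [show n + 1 - ((descendants V u n).card + 0) - 1 = b + 1 by omega]
          simp
    simp_rw [h]
    rw [Finset.sum_add_distrib, sum_ite_mem_Icc descendants_subset_Icc,
      sum_ite_mem_Icc descendants_subset_Icc]
    unfold tieWeight
    rw [if_pos hv, ha, Nat.add_sub_cancel,
      show n - (descendants V u n).card - 1 = b by omega]
    have hb' : (n : ℝ) = (descendants V u n).card + b + 1 := by exact_mod_cast hb
    refine le_of_eq ?_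
    push_cast
    rw [hb']
    linear_combination tieDensity_harmonic a b
  · have h : ∀ k, tieWeight u v (n + 1) (Function.update V n k) = 0 := fun k => by
      unfold tieWeight
      rw [if_neg fun h => hv ((hmem k).1 h)]
    simp_rw [h]
    simp [tieWeight, hv]

end Urns

/-! ### Almost sure consequences of bounded weights. -/

section AlmostSure

variable {Ω : Type*} {mΩ : MeasurableSpace Ω} {μ : Measure Ω} [IsProbabilityMeasure μ]
  {U : ℕ → Ω → ℕ}

/-- The proportion of non-descendants of `u` is bounded below. -/
theorem IsUniformAttachment.ae_exists_pos_mul_le (hU : IsUniformAttachment μ U)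
    (hatt : ∀ ω, IsAttachment fun m => U m ω) {u : ℕ} (hu : 2 ≤ u) :
    ∀ᵐ ω ∂μ, ∃ δ : ℝ, 0 < δ ∧ ∀ n, u ≤ n →
      δ * n ≤ n - (descendants (fun m => U m ω) u n).card := by
  filter_upwards [hU.ae_bounded hatt (φ := complementWeight u) hu
    (fun n x y hxy => by
      have : descendants x u n = descendants y u n := dependsOnChoices_descendants u n hxy
      simp only [complementWeight, this])
    (fun n _ V _ => div_nonneg (centralBinomRatio_pos _).le (centralBinomRatio_pos _).le)
    (fun n hn V _ => sum_complementWeight_le hu hn)] with ω ⟨C, hC⟩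
  -- With j + 1 non-descendants, the binomial bounds give n ≤ (4j + 1)C², hence n ≤ 4(j + 1)(C² +
  -- 1).
  refine ⟨1 / (4 * (C ^ 2 + 1)), by positivity, fun n hn => ?_⟩
  have h := hC n hn
  have hlt : (descendants (fun m => U m ω) u n).card < n := card_descendants_lt hu (by omega)
  unfold complementWeight at h
  generalize (descendants (fun m => U m ω) u n).card = s at hlt h
  obtain ⟨j, rfl⟩ : ∃ j, n = s + j + 1 := ⟨n - s - 1, by omega⟩
  rw [show s + j + 1 - s - 1 = j by omega, Nat.add_sub_cancel,
    div_le_iff₀ (centralBinomRatio_pos _)] at h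
  have h1 := one_le_mul_sq_centralBinomRatio j
  have h2 := mul_sq_centralBinomRatio_le (s + j)
  have h3 : centralBinomRatio j ^ 2 ≤ C ^ 2 * centralBinomRatio (s + j) ^ 2 := by
    rw [← mul_pow]
    exact pow_le_pow_left₀ (centralBinomRatio_pos _).le h 2
  rw [div_mul_eq_mul_div, one_mul, div_le_iff₀ (by positivity)]
  push_cast at h2 ⊢
  have h4 : (s + j + 1 : ℝ) ≤ (4 * j + 1) * C ^ 2 := by
    calc (s + j + 1 : ℝ) ≤ (s + j + 1) * ((4 * j + 1) * centralBinomRatio j ^ 2) :=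
          le_mul_of_one_le_right (by positivity) h1
      _ ≤ (s + j + 1) * ((4 * j + 1) * (C ^ 2 * centralBinomRatio (s + j) ^ 2)) := by gcongr
      _ = (4 * j + 1) * C ^ 2 * ((s + j + 1) * centralBinomRatio (s + j) ^ 2) := by ring
      _ ≤ (4 * j + 1) * C ^ 2 := mul_le_of_le_one_right (by positivity) h2
  nlinarith [sq_nonneg C, Nat.cast_nonneg (α := ℝ) j]

/-- Late vertices have a uniformly small proportion of descendants. -/
theorem IsUniformAttachment.ae_card_descendants_lt (hU : IsUniformAttachment μ U)
    (hatt : ∀ ω, IsAttachment fun m => U m ω) :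
    ∀ᵐ ω ∂μ, ∀ ε : ℝ, 0 < ε → ∃ K, ∀ v n, 2 ≤ v → K ≤ v → v ≤ n →
      ((descendants (fun m => U m ω) v n).card : ℝ) < ε * n := by
  filter_upwards [hU.ae_bounded hatt (φ := cubicWeight) le_rfl
    (fun n x y hxy => by
      have : ∀ v, descendants x v n = descendants y v n :=
        fun v => dependsOnChoices_descendants v n hxy
      simp only [cubicWeight, this])
    (fun _ _ _ _ => cubicWeight_nonneg)
    (fun n hn V _ => sum_cubicWeight_le hn)] with ω ⟨C, hC⟩ ε hε
  -- A share of at least ε forces v ε³ ≤ 6C; the 6 comes from n(n+1)(n+2) ≤ 6n³.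
  obtain ⟨K, hK⟩ := exists_nat_gt (6 * C / ε ^ 3)
  refine ⟨K, fun v n hv hKv hvn => ?_⟩
  by_contra! hle
  have h := hC n (by omega)
  have h1 : cubicTerm v (descendants (fun m => U m ω) v n).card n ≤ C := by
    refine le_trans ?_ h
    unfold cubicWeight
    refine le_trans ?_ (le_add_of_nonneg_right (by positivity))
    exact Finset.single_le_sum
      (f := fun v : ℕ => cubicTerm v (descendants (fun m => U m ω) v n).card n)
      (fun _ _ => cubicTerm_nonneg _ _ _) (Finset.mem_Icc.2 ⟨hv, hvn⟩)
  have hn1 : (1 : ℝ) ≤ n := by exact_mod_cast (by omega : 1 ≤ n)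
  have hv0 : (0 : ℝ) < v := by positivity
  have hC0 : 0 ≤ C := le_trans (cubicTerm_nonneg _ _ _) h1
  have hKv' : 6 * C / ε ^ 3 < v := hK.trans_le (by exact_mod_cast hKv)
  rw [cubicTerm, div_le_iff₀ (by positivity)] at h1
  rw [div_lt_iff₀ (by positivity)] at hKv'
  generalize ((descendants (fun m => U m ω) v n).card : ℝ) = s at h1 hle
  have hs : 0 ≤ ε * n := by positivity
  have h2 : (ε * n) ^ 3 ≤ s * (s + 1) * (s + 2) := by
    calc (ε * n) ^ 3 ≤ s ^ 3 := pow_le_pow_left₀ hs hle 3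
      _ ≤ s * (s + 1) * (s + 2) := by nlinarith [sq_nonneg s]
  have h3 : (n : ℝ) * (n + 1) * (n + 2) ≤ 6 * n ^ 3 := by
    calc (n : ℝ) * (n + 1) * (n + 2) ≤ n * (n + n) * (n + 2 * n) := by gcongr; linarith
      _ = 6 * n ^ 3 := by ring
  have h4 : v * (ε * n) ^ 3 ≤ 6 * C * n ^ 3 := by
    calc v * (ε * n) ^ 3 ≤ v * (s * (s + 1) * (s + 2)) := by gcongr
      _ ≤ C * (n * (n + 1) * (n + 2)) := h1
      _ ≤ C * (6 * n ^ 3) := by gcongr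
      _ = 6 * C * n ^ 3 := by ring
  have h5 : 6 * C * (n : ℝ) ^ 3 < v * ε ^ 3 * n ^ 3 := by gcongr
  rw [mul_pow] at h4
  linarith

/-- Discrete intermediate values: with unit steps, a sign change has to pass through zero. -/
theorem eventually_pos_or_eventually_neg {D : ℕ → ℤ} {n₀ : ℕ} (h : ∀ n, n₀ ≤ n → D n ≠ 0)
    (hstep : ∀ n, n₀ ≤ n → |D (n + 1) - D n| ≤ 1) :
    (∀ᶠ n in atTop, 0 ≤ D n) ∨ ∀ᶠ n in atTop, D n < 0 := by
  rcases lt_or_gt_of_ne (h n₀ le_rfl) with h0 | h0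
  · refine Or.inr (eventually_atTop.2 ⟨n₀, fun n hn => ?_⟩)
    induction n, hn using Nat.le_induction with
    | base => exact h0
    | succ n hn ih =>
      have h1 := abs_le.1 (hstep n hn)
      have h2 := h (n + 1) (by omega)
      omega
  · refine Or.inl (eventually_atTop.2 ⟨n₀, fun n hn => le_of_lt ?_⟩)
    induction n, hn using Nat.le_induction with
    | base => exact h0
    | succ n hn ih =>
      have h1 := abs_le.1 (hstep n hn)
      have h2 := h (n + 1) (by omega)
      omega

theorem IsUniformAttachment.ae_eventually_of_le (hU : IsUniformAttachment μ U)
    (hatt : ∀ ω, IsAttachment fun m => U m ω) {u v : ℕ} (hu : 2 ≤ u) (huv : u ≤ v) :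
    ∀ᵐ ω ∂μ,
      (∀ᶠ n in atTop, n ≤ (descendants (fun m => U m ω) u n).card
        + (descendants (fun m => U m ω) v n).card) ∨
      ∀ᶠ n in atTop, ¬ n ≤ (descendants (fun m => U m ω) u n).card
        + (descendants (fun m => U m ω) v n).card := by
  filter_upwards [hU.ae_exists_pos_mul_le hatt hu,
    hU.ae_bounded hatt (φ := tieWeight u v) (hu.trans huv)
    (fun n x y hxy => by
      have : ∀ v, descendants x v n = descendants y v n :=
        fun v => dependsOnChoices_descendants v n hxy
      simp only [tieWeight, this])
    (fun _ _ _ _ => tieWeight_nonneg)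
    (fun n hn V _ => sum_tieWeight_le hu huv hn)] with ω ⟨δ, hδ, hδn⟩ ⟨C, hC⟩
  by_cases hv : v ∈ descendants (fun m => U m ω) u v
  · obtain ⟨N, hN⟩ := exists_nat_gt ((C ^ 2 + 1) / δ)
    have key := eventually_pos_or_eventually_neg (n₀ := max N v)
      (D := fun n => ((descendants (fun m => U m ω) u n).card : ℤ)
        + (descendants (fun m => U m ω) v n).card - n) ?_ ?_
    · refine key.imp (fun h => h.mono fun n hn => ?_) fun h => h.mono fun n hn => ?_ <;> omega
    · intro n hn h0
      have hvn : v ≤ n := (le_max_right _ _).trans hn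
      have hCn := hC n hvn
      have hpos : 1 ≤ (descendants (fun m => U m ω) v n).card :=
        card_descendants_pos (by omega) hvn
      obtain ⟨a, ha⟩ : ∃ a, (descendants (fun m => U m ω) v n).card = a + 1 :=
        ⟨_, (Nat.sub_add_cancel hpos).symm⟩
      unfold tieWeight at hCn
      rw [if_pos ((mem_descendants_iff_of_le le_rfl hvn).2 hv), ha, Nat.add_sub_cancel,
        show n - (descendants (fun m => U m ω) u n).card - 1 = a by omega] at hCn
      have h1 : (a : ℝ) ≤ C ^ 2 := (le_sq_tieDensity_self a).trans
        (pow_le_pow_left₀ (tieDensity_nonneg _ _) hCn 2)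
      have h2 := hδn n (huv.trans hvn)
      have h3 : (n : ℝ) - (descendants (fun m => U m ω) u n).card = a + 1 := by
        have : (n : ℤ) = (descendants (fun m => U m ω) u n).card + (a + 1) := by omega
        have : (n : ℝ) = (descendants (fun m => U m ω) u n).card + (a + 1) := by exact_mod_cast this
        linarith
      have h4 : (C ^ 2 + 1) / δ < n :=
        hN.trans_le (by exact_mod_cast (le_max_left _ _).trans hn)
      rw [div_lt_iff₀ hδ] at h4
      linarith
    · intro n hn
      have hvn : v ≤ n := (le_max_right _ _).trans hn
      have hsub := descendants_subset (n := n) hv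
      rw [card_descendants_succ hvn, card_descendants_succ (huv.trans hvn), abs_le]
      have : U n ω ∈ descendants (fun m => U m ω) v n → U n ω ∈ descendants (fun m => U m ω) u n :=
        fun h => hsub h
      split_ifs <;> first | (exfalso; tauto) | (push_cast; constructor <;> linarith)
  · refine Or.inr (eventually_atTop.2 ⟨1, fun n hn => ?_⟩)
    have := card_descendants_add_lt_of_notMem hu huv hv hn
    omega

theorem IsUniformAttachment.ae_eventually (hU : IsUniformAttachment μ U)
    (hatt : ∀ ω, IsAttachment fun m => U m ω) {u v : ℕ} (hu : 2 ≤ u) (hv : 2 ≤ v) :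
    ∀ᵐ ω ∂μ,
      (∀ᶠ n in atTop, n ≤ (descendants (fun m => U m ω) u n).card
        + (descendants (fun m => U m ω) v n).card) ∨
      ∀ᶠ n in atTop, ¬ n ≤ (descendants (fun m => U m ω) u n).card
        + (descendants (fun m => U m ω) v n).card := by
  rcases le_total u v with h | h
  · exact hU.ae_eventually_of_le hatt hu h
  · filter_upwards [hU.ae_eventually_of_le hatt hv h] with ω hω
    simpa only [add_comm] using hω

end AlmostSure

/-! ### Reduction to finitely many pairs. -/

section Stabilization

variable {V : ℕ → ℕ}

/-- Only finitely many vertices are ever relevant for the Jordan rank of the root. -/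
theorem exists_forall_lt_of_le_card_add
    (hpos : ∀ u, 2 ≤ u → ∃ δ : ℝ, 0 < δ ∧ ∀ n, u ≤ n → δ * n ≤ n - (descendants V u n).card)
    (hsmall : ∀ ε : ℝ, 0 < ε → ∃ K, ∀ v n, 2 ≤ v → K ≤ v → v ≤ n →
      ((descendants V v n).card : ℝ) < ε * n) :
    ∃ K, ∀ n, ∀ u ∈ Finset.Icc 2 n, ∀ v ∈ Finset.Icc 2 n,
      n ≤ (descendants V u n).card + (descendants V v n).card → u ≤ K ∧ v ≤ K := by
  -- The larger member of a relevant pair has at least n/2 descendants, so its label is below `K₀`.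
  -- For each such `u`, the partner needs at least n - D_u ≥ δn descendants, which bounds its label
  -- by `K u`.
  obtain ⟨K₀, hK₀⟩ := hsmall (1 / 2) (by norm_num)
  have hK : ∀ u, ∃ K, 2 ≤ u → ∀ v n, 2 ≤ v → u ≤ n → v ≤ n →
      n ≤ (descendants V u n).card + (descendants V v n).card → v ≤ K := by
    intro u
    by_cases hu : 2 ≤ u
    · obtain ⟨δ, hδ, hδn⟩ := hpos u hu
      obtain ⟨K, hK⟩ := hsmall δ hδ
      refine ⟨K, fun _ v n hv hun hvn h => ?_⟩
      by_contra! hKv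
      have h1 := hK v n hv hKv.le hvn
      have h2 := hδn n hun
      have h3 : (n : ℝ) ≤ (descendants V u n).card + (descendants V v n).card := by
        exact_mod_cast h
      linarith
    · exact ⟨0, fun h => absurd h hu⟩
  choose K hK using hK
  have key : ∀ n, ∀ u ∈ Finset.Icc 2 n, ∀ v ∈ Finset.Icc 2 n,
      n ≤ (descendants V u n).card + (descendants V v n).card →
      (descendants V v n).card ≤ (descendants V u n).card →
      u ≤ K₀ + (Finset.range K₀).sup K ∧ v ≤ K₀ + (Finset.range K₀).sup K := by
    intro n u hu v hv h hvu
    rw [Finset.mem_Icc] at hu hv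
    have hu₀ : u < K₀ := by
      by_contra! hKu
      have h1 := hK₀ u n hu.1 hKu hu.2
      have h2 : (n : ℝ) ≤ (descendants V u n).card + (descendants V u n).card := by
        exact_mod_cast h.trans (by omega)
      linarith
    have h1 := hK u hu.1 v n hv.1 hu.2 hv.2 h
    have h2 := Finset.le_sup (f := K) (Finset.mem_range.2 hu₀)
    omega
  refine ⟨K₀ + (Finset.range K₀).sup K, fun n u hu v hv h => ?_⟩
  rcases le_total (descendants V v n).card (descendants V u n).card with hvu | hvu
  · exact key n u hu v hv h hvu
  · exact (key n v hv u hu (by rwa [add_comm]) hvu).symm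

open Classical in
theorem exists_eventually_rootJordanRank_eq (hV : IsAttachment V)
    (hpos : ∀ u, 2 ≤ u → ∃ δ : ℝ, 0 < δ ∧ ∀ n, u ≤ n → δ * n ≤ n - (descendants V u n).card)
    (hsmall : ∀ ε : ℝ, 0 < ε → ∃ K, ∀ v n, 2 ≤ v → K ≤ v → v ≤ n →
      ((descendants V v n).card : ℝ) < ε * n)
    (hev : ∀ u, 2 ≤ u → ∀ v, 2 ≤ v →
      (∀ᶠ n in atTop, n ≤ (descendants V u n).card + (descendants V v n).card) ∨
      ∀ᶠ n in atTop, ¬ n ≤ (descendants V u n).card + (descendants V v n).card) :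
    ∃ r, ∀ᶠ n in atTop, rootJordanRank V n = r := by
  obtain ⟨K, hK⟩ := exists_forall_lt_of_le_card_add hpos hsmall
  have h : ∀ᶠ n in atTop, ∀ u ∈ Finset.Icc 2 K, ∀ v ∈ Finset.Icc 2 K,
      (n ≤ (descendants V u n).card + (descendants V v n).card ↔
        ∀ᶠ n in atTop, n ≤ (descendants V u n).card + (descendants V v n).card) := by
    rw [eventually_all_finset]
    intro u hu
    rw [eventually_all_finset]
    intro v hv
    rcases hev u (Finset.mem_Icc.1 hu).1 v (Finset.mem_Icc.1 hv).1 with h | h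
    · filter_upwards [h] with n hn
      exact iff_of_true hn h
    · filter_upwards [h] with n hn
      refine iff_of_false hn fun h' => ?_
      obtain ⟨m, h1, h2⟩ := (h.and h').exists
      exact h1 h2
  refine ⟨1 + ((Finset.Icc 2 K).filter fun v : ℕ => ∃ u ∈ Finset.Icc 2 K,
    ∀ᶠ n in atTop, n ≤ (descendants V u n).card + (descendants V v n).card).card, ?_⟩
  filter_upwards [h, eventually_ge_atTop (K + 1)] with n hn hKn
  rw [rootJordanRank_eq hV (by omega)]
  congr 2
  ext v
  simp only [Finset.mem_filter]
  constructor
  · rintro ⟨hv, u, hu, h⟩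
    obtain ⟨huK, hvK⟩ := hK n u hu v hv h
    have hu' := Finset.mem_Icc.2 ⟨(Finset.mem_Icc.1 hu).1, huK⟩
    have hv' := Finset.mem_Icc.2 ⟨(Finset.mem_Icc.1 hv).1, hvK⟩
    exact ⟨hv', u, hu', (hn u hu' v hv').1 h⟩
  · rintro ⟨hv, u, hu, h⟩
    have hsub : Finset.Icc 2 K ⊆ Finset.Icc 2 n := Finset.Icc_subset_Icc_right (by omega)
    exact ⟨hsub hv, u, hsub hu, (hn u hu v hv).2 h⟩

end Stabilization

/-! ### Measurable limits and null-set modifications. -/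

section Measurability

variable {Ω : Type*} {mΩ : MeasurableSpace Ω} {μ : Measure Ω}

open Classical in
/-- An almost surely eventually constant sequence of measurable functions has a measurable
eventual value, attained from a measurable time on. -/
theorem exists_measurable_of_ae_eventually_const {f : ℕ → Ω → ℕ} (hf : ∀ n, Measurable (f n))
    (h : ∀ᵐ ω ∂μ, ∃ r, ∀ᶠ n in atTop, f n ω = r) :
    ∃ R N : Ω → ℕ, Measurable R ∧ Measurable N ∧ ∀ᵐ ω ∂μ, ∀ n, N ω ≤ n → f n ω = R ω := by
  let S : ℕ → Set Ω := fun N => {ω | ∀ n, N ≤ n → f n ω = f N ω}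
  have hS : ∀ N, MeasurableSet (S N) := fun N => by
    simp only [S, Set.ofPred_forall]
    exact MeasurableSet.iInter fun n => MeasurableSet.iInter fun _ =>
      measurableSet_eq_fun (hf n) (hf N)
  -- The second alternative makes the search for a least `N` terminate everywhere, with value 0
  -- where the sequence never stabilizes.
  let p : ℕ → Ω → Prop := fun N ω => ω ∈ S N ∨ ω ∉ ⋃ M, S M
  have hp : ∀ N, MeasurableSet {ω | p N ω} := fun N =>
    (hS N).union (MeasurableSet.iUnion hS).compl
  have hex : ∀ ω, ∃ N, p N ω := fun ω => by
    by_cases hω : ω ∈ ⋃ M, S M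
    · obtain ⟨M, hM⟩ := Set.mem_iUnion.1 hω
      exact ⟨M, Or.inl hM⟩
    · exact ⟨0, Or.inr hω⟩
  refine ⟨fun ω => f (Nat.find (hex ω)) ω, fun ω => Nat.find (hex ω), Measurable.find hf hp hex,
    measurable_find hex hp, ?_⟩
  filter_upwards [h] with ω ⟨r, hr⟩
  obtain ⟨M, hM⟩ := eventually_atTop.1 hr
  have hω : ω ∈ ⋃ M, S M :=
    Set.mem_iUnion.2 ⟨M, fun n hn => (hM n hn).trans (hM M le_rfl).symm⟩
  rcases Nat.find_spec (hex ω) with h' | h'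
  · exact h'
  · exact absurd hω h'

variable {U : ℕ → Ω → ℕ}

/-- Changing the choices on a null set makes every realization a genuine attachment sequence. -/
theorem IsUniformAttachment.exists_isAttachment (hU : IsUniformAttachment μ U) :
    ∃ U' : ℕ → Ω → ℕ, IsUniformAttachment μ U' ∧ (∀ ω, IsAttachment fun m => U' m ω) ∧
      ∀ᵐ ω ∂μ, ∀ m, 1 ≤ m → U m ω = U' m ω := by
  have hae : ∀ m, 1 ≤ m → ∀ᵐ ω ∂μ, max 1 (min (U m ω) m) = U m ω := by
    intro m hm
    have h : ∀ᵐ k ∂(uniformOn (Set.Icc 1 m)), k ∈ Set.Icc 1 m := by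
      have := isProbabilityMeasure_uniformOn (Set.finite_Icc 1 m) ⟨1, by simp [hm]⟩
      exact (prob_compl_eq_zero_iff measurableSet_Icc).2
        (uniformOn_self (Set.finite_Icc 1 m) ⟨1, by simp [hm]⟩)
    rw [← hU.uniform m hm] at h
    filter_upwards [ae_of_ae_map (hU.measurable m hm).aemeasurable h] with ω hω
    have := Set.mem_Icc.1 hω
    omega
  -- Clamping each choice to its range acts coordinatewise, so independence survives.
  refine ⟨fun m ω => max 1 (min (U m ω) m), ⟨fun m hm => ?_, fun m hm => ?_, ?_⟩, ?_, ?_⟩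
  · exact measurable_const.max ((hU.measurable m hm).min measurable_const)
  · rw [← hU.uniform m hm]
    exact Measure.map_congr (hae m hm)
  · exact hU.indep.comp (fun n k => max 1 (min k (n + 1))) fun _ => Measurable.of_discrete
  · intro ω m hm
    dsimp only
    omega
  · rw [ae_all_iff]
    intro m
    by_cases hm : 1 ≤ m
    · filter_upwards [hae m hm] with ω hω _ using hω.symm
    · exact ae_of_all _ fun ω h => absurd h hm

theorem IsUniformAttachment.measurable_rootJordanRank (hU : IsUniformAttachment μ U) (n : ℕ) :
    Measurable fun ω => rootJordanRank (fun m => U m ω) n := by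
  have h : DependsOnChoices (fun V => rootJordanRank V n) (n + 2) := by
    intro x y hxy
    have : attachmentTree x n = attachmentTree y n := by
      unfold attachmentTree
      congr 1
      ext a b
      refine exists_congr fun m => and_congr_right fun hm => ?_
      refine and_congr_left fun h => ?_
      have hxy' : x m = y m := hxy m ⟨hm, by have := b.2.2; omega⟩
      rw [hxy']
    simp only [rootJordanRank, this]
  exact (hU.measurable_filtration h).mono (hU.filtration.le n) le_rfl

end Measurability

/-! ### Persistence of the root's rank. -/

theorem mainTheorem3 {Ω : Type*} [MeasurableSpace Ω] (μ : Measure Ω) [IsProbabilityMeasure μ]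
    (U : ℕ → Ω → ℕ) (hU : IsUniformAttachment μ U) :
    ∃ R N : Ω → ℕ, Measurable R ∧ Measurable N ∧
      ∀ᵐ ω ∂μ,
        Tendsto (fun n : ℕ => rootJordanRank (fun m => U m ω) n) atTop (𝓝 (R ω)) ∧
        ∀ n : ℕ, N ω ≤ n → rootJordanRank (fun m => U m ω) n = R ω := by
  obtain ⟨U', hU', hatt, hUU'⟩ := hU.exists_isAttachment
  have hpos : ∀ᵐ ω ∂μ, ∀ u, 2 ≤ u → ∃ δ : ℝ, 0 < δ ∧ ∀ n, u ≤ n →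
      δ * n ≤ n - (descendants (fun m => U' m ω) u n).card := by
    simp_rw [ae_all_iff]
    exact fun u hu => hU'.ae_exists_pos_mul_le hatt hu
  have hev : ∀ᵐ ω ∂μ, ∀ u, 2 ≤ u → ∀ v, 2 ≤ v →
      (∀ᶠ n in atTop, n ≤ (descendants (fun m => U' m ω) u n).card
        + (descendants (fun m => U' m ω) v n).card) ∨
      ∀ᶠ n in atTop, ¬ n ≤ (descendants (fun m => U' m ω) u n).card
        + (descendants (fun m => U' m ω) v n).card := by
    simp_rw [ae_all_iff]
    exact fun u hu v hv => hU'.ae_eventually hatt hu hv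
  have hconst : ∀ᵐ ω ∂μ, ∃ r, ∀ᶠ n in atTop, rootJordanRank (fun m => U m ω) n = r := by
    filter_upwards [hUU', hpos, hU'.ae_card_descendants_lt hatt, hev] with ω h1 h2 h3 h4
    simp_rw [rootJordanRank_congr h1]
    exact exists_eventually_rootJordanRank_eq (hatt ω) h2 h3 h4
  obtain ⟨R, N, hR, hN, h⟩ :=
    exists_measurable_of_ae_eventually_const hU.measurable_rootJordanRank hconst
  refine ⟨R, N, hR, hN, ?_⟩
  filter_upwards [h] with ω hω
  exact ⟨tendsto_atTop_of_eventually_const hω, hω⟩
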